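/- Let $R$ be a commutative artinian ring (associative, with unity). A submodule $F$ of an $R$-module $E$ is called an RD-submodule if $rE\cap F=rF$ for every $r\in R$, and an exact sequence of $R$-modules $0\to N\to M\to L\to 0$ is called RD-exact if the image of $N$ is an RD-submodule of $M$. An $R$-module $F$ is called RD-injective if for every RD-exact sequence $0\to N\to M\to L\to 0$ of $R$-modules the induced sequence $$0\to \mathrm{Hom}_R(L,F)\to \mathrm{Hom}_R(M,F)\to \mathrm{Hom}_R(N,F)\to 0$$ is exact. A commutative ring is called quasi-Frobenius if it is noetherian and injective as a module over itself. Then $R$ is RD-injective as a module over itself if and only if $R$ is a quasi-Frobenius ring. -/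

import Mathlib

open scoped Pointwise

universe u v

/-- A submodule `F` of `E` is an RD-submodule (relatively divisible submodule) if
`rE ∩ F = rF` for every `r ∈ R`. -/
def IsRDSubmodule {R : Type u} [CommRing R] {E : Type v} [AddCommGroup E] [Module R E]
    (F : Submodule R E) : Prop :=
  ∀ r : R, (r • (⊤ : Submodule R E)) ⊓ F = r • F

/-- `0 → A → B → C → 0`, with maps `f` and `g`, is a short exact sequence. -/
def IsShortExactSeq {R : Type u} [CommRing R] {A B C : Type*}
    [AddCommGroup A] [Module R A] [AddCommGroup B] [Module R B] [AddCommGroup C] [Module R C]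
    (f : A →ₗ[R] B) (g : B →ₗ[R] C) : Prop :=
  Function.Injective f ∧ Function.Exact f g ∧ Function.Surjective g

/-- `0 → N → M → L → 0` is RD-exact: it is exact and the image of `N` is an RD-submodule
of `M`. -/
def IsRDExactSeq {R : Type u} [CommRing R] {N M L : Type*}
    [AddCommGroup N] [Module R N] [AddCommGroup M] [Module R M] [AddCommGroup L] [Module R L]
    (f : N →ₗ[R] M) (g : M →ₗ[R] L) : Prop :=
  IsShortExactSeq f g ∧ IsRDSubmodule (LinearMap.range f)

/-- `F` is RD-injective if for every RD-exact sequence `0 → N → M → L → 0` of `R`-modules the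
sequence `0 → Hom(L, F) → Hom(M, F) → Hom(N, F) → 0` is exact. -/
def IsRDInjective (R : Type u) [CommRing R] (F : Type v) [AddCommGroup F] [Module R F] : Prop :=
  ∀ (N M L : Type (max u v)) [AddCommGroup N] [AddCommGroup M] [AddCommGroup L]
    [Module R N] [Module R M] [Module R L] (f : N →ₗ[R] M) (g : M →ₗ[R] L),
    IsRDExactSeq f g → IsShortExactSeq (LinearMap.lcomp R F g) (LinearMap.lcomp R F f)

/-- A commutative ring is quasi-Frobenius if it is noetherian and injective as a module over
itself. -/
def IsQuasiFrobenius (R : Type u) [CommRing R] : Prop :=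
  IsNoetherianRing R ∧ Module.Injective R R

/-! Injective modules are RD-injective, and artinian rings are noetherian; the work is in showing
that RD-injectivity makes `R` injective. Applied to a pushout of a presentation, it shows that a
finitely generated module with an essential element embeds in some `R ⧸ (s)`
(`exists_injective_quotient_span`), so such modules have length at most that of `R`. One of maximal
length, for a given maximal ideal `P` annihilating the essential element, is injective; it splits
off `R ⧸ (s)`, hence is cyclic, say `R ⧸ J P`. The ideals `J P` are pairwise coprime with zero
intersection, so `R` is the product of the injective modules `R ⧸ J P`. -/

/-- An element is essential if it is nonzero and lies in every nonzero submodule. -/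
def IsEssentialElement (R : Type*) [CommRing R] {E : Type*} [AddCommGroup E] [Module R E]
    (σ : E) : Prop :=
  σ ≠ 0 ∧ ∀ N : Submodule R E, N ≠ ⊥ → σ ∈ N

section

variable {R : Type u} [CommRing R]

theorem IsEssentialElement.ker_eq_bot {E F : Type*} [AddCommGroup E] [Module R E]
    [AddCommGroup F] [Module R F] {σ : E} (hσ : IsEssentialElement R σ) (f : E →ₗ[R] F)
    (h : f σ ≠ 0) : LinearMap.ker f = ⊥ := by
  by_contra hk
  exact h (hσ.2 _ hk)

/-- A linear map out of a module presented by the rows of a matrix `A`, with values in a quotient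
of the ring. -/
theorem exists_hom_quotient_of_mulVec_mem {E : Type*} [AddCommGroup E] [Module R E] {n m : ℕ}
    (π : (Fin n → R) →ₗ[R] E) (hπ : Function.Surjective π) (A : Matrix (Fin m) (Fin n) R)
    (hA : ∀ x, π x = 0 → ∃ w, x = Matrix.vecMul w A) (I : Ideal R) (y : Fin n → R)
    (hy : ∀ k, A.mulVec y k ∈ I) :
    ∃ f : E →ₗ[R] R ⧸ I, ∀ x, f (π x) = Submodule.Quotient.mk (x ⬝ᵥ y) := by
  let φ : (Fin n → R) →ₗ[R] R ⧸ I := (Submodule.mkQ I) ∘ₗ (dotProductBilin R R).flip y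
  have hφ : LinearMap.ker π ≤ LinearMap.ker φ := by
    intro x hx
    obtain ⟨w, rfl⟩ := hA x hx
    change Submodule.Quotient.mk (Matrix.vecMul w A ⬝ᵥ y) = 0
    rw [Submodule.Quotient.mk_eq_zero, ← Matrix.dotProduct_mulVec]
    exact Submodule.sum_mem _ fun k _ => I.mul_mem_left _ (hy k)
  refine ⟨(LinearMap.ker π).liftQ φ hφ ∘ₗ (π.quotKerEquivOfSurjective hπ).symm, fun x => ?_⟩
  have : (π.quotKerEquivOfSurjective hπ).symm (π x) = Submodule.Quotient.mk x := by
    rw [LinearEquiv.symm_apply_eq]; rfl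
  simp only [LinearMap.comp_apply, LinearEquiv.coe_coe, this]
  rfl

/-- If `R` is RD-injective, then any functional `z` which preserves all the divisibilities of the
rows of a matrix `A` is a linear combination of these rows. -/
theorem IsRDInjective.exists_eq_vecMul (hR : IsRDInjective R R) {n m : ℕ}
    (A : Matrix (Fin m) (Fin n) R) (z : Fin n → R)
    (h : ∀ (s : R) (y : Fin n → R), (∀ k, s ∣ A.mulVec y k) → s ∣ z ⬝ᵥ y) :
    ∃ w, z = Matrix.vecMul w A := by
  let D : (Fin n → R) →ₗ[R] (Fin m → R) × R := A.mulVecLin.prod (dotProductBilin R R z)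
  -- The pushout of `A` and `z`: a retraction of `i` is exactly a way to factor `z` through `A`, and
  -- `h` says that `i` is an RD-embedding.
  let i : R →ₗ[R] ((Fin m → R) × R) ⧸ LinearMap.range D :=
    (LinearMap.range D).mkQ ∘ₗ LinearMap.inr R (Fin m → R) R
  have hi : Function.Injective i := by
    rw [injective_iff_map_eq_zero]
    intro r hr
    obtain ⟨y, hy⟩ := (Submodule.Quotient.mk_eq_zero _).1 hr
    have h1 : A.mulVec y = 0 := congrArg Prod.fst hy
    have h2 : z ⬝ᵥ y = r := congrArg Prod.snd hy
    rw [← h2]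
    -- Divisibility by `0` means vanishing, so injectivity is the case `s = 0` of `h`.
    exact zero_dvd_iff.1 (h 0 y fun k => by rw [h1]; rfl)
  have hrd : IsRDSubmodule (LinearMap.range i) := by
    intro s
    apply le_antisymm
    · rintro _ ⟨hx, r, rfl⟩
      obtain ⟨q, -, hq⟩ := Submodule.mem_smul_pointwise_iff_exists _ _ _ |>.1 hx
      obtain ⟨⟨w, t⟩, rfl⟩ := Submodule.Quotient.mk_surjective _ q
      obtain ⟨y, hy⟩ := (Submodule.Quotient.eq _).1
        (show Submodule.Quotient.mk (p := LinearMap.range D) ((0, r) : (Fin m → R) × R)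
          = Submodule.Quotient.mk (s • (w, t)) from hq.symm)
      have h1 : A.mulVec y = 0 - s • w := congrArg Prod.fst hy
      have h2 : z ⬝ᵥ y = r - s * t := congrArg Prod.snd hy
      have h3 : s ∣ r - s * t := by
        rw [← h2]
        refine h s y fun k => ?_
        rw [h1]
        exact ⟨-w k, by simp⟩
      obtain ⟨c, hc⟩ := h3
      refine Submodule.mem_smul_pointwise_iff_exists _ _ _ |>.2 ⟨i (c + t), LinearMap.mem_range_self i _, ?_⟩
      rw [← map_smul]
      congr 1
      rw [smul_eq_mul]
      linear_combination -hc
    · intro x hx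
      obtain ⟨q, hq, rfl⟩ := Submodule.mem_smul_pointwise_iff_exists _ _ _ |>.1 hx
      exact ⟨Submodule.smul_mem_pointwise_smul q s ⊤ trivial, Submodule.smul_mem _ _ hq⟩
  obtain ⟨g, hg⟩ := (hR R _ _ i (LinearMap.range i).mkQ
    ⟨⟨hi, LinearMap.exact_map_mkQ_range i, Submodule.mkQ_surjective _⟩, hrd⟩).2.2 LinearMap.id
  have hg1 : ∀ r, g (i r) = r := fun r => LinearMap.congr_fun hg r
  let γ : (Fin m → R) →ₗ[R] R :=
    g ∘ₗ (LinearMap.range D).mkQ ∘ₗ LinearMap.inl R (Fin m → R) R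
  have hγ : ∀ w, γ w = (fun k => γ (Pi.single k 1)) ⬝ᵥ w := by
    intro w
    conv_lhs => rw [pi_eq_sum_univ' w]
    simp [dotProduct, mul_comm]
  refine ⟨-fun k => γ (Pi.single k 1), dotProduct_eq _ _ fun y => ?_⟩
  have h0 : γ (A.mulVec y) + z ⬝ᵥ y = 0 := by
    rw [← hg1 (z ⬝ᵥ y)]
    change g (Submodule.Quotient.mk (A.mulVec y, 0)) + g (Submodule.Quotient.mk (0, z ⬝ᵥ y)) = 0
    rw [← map_add, ← Submodule.Quotient.mk_add, Prod.mk_add_mk, add_zero, zero_add]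
    have hq : Submodule.Quotient.mk (p := LinearMap.range D) (D y) = 0 :=
      (Submodule.Quotient.mk_eq_zero _).2 (LinearMap.mem_range_self D y)
    exact (congrArg g hq).trans (map_zero g)
  rw [Matrix.neg_vecMul, neg_dotProduct, ← Matrix.dotProduct_mulVec, ← hγ]
  linear_combination h0

/-- Over a noetherian RD-injective ring, every finitely generated module with an essential element
embeds into a cyclic module with principal annihilator. -/
theorem IsRDInjective.exists_injective_quotient_span [IsNoetherianRing R]
    (hR : IsRDInjective R R) {E : Type*} [AddCommGroup E] [Module R E] [Module.Finite R E] {σ : E}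
    (hσ : IsEssentialElement R σ) :
    ∃ (s : R) (f : E →ₗ[R] R ⧸ Ideal.span {s}), Function.Injective f := by
  by_contra! hE
  obtain ⟨n, π, hπ⟩ := Module.Finite.exists_fin' R E
  obtain ⟨m, ρ, hρ⟩ := Module.Finite.exists_fin' R (LinearMap.ker π)
  let A : Matrix (Fin m) (Fin n) R := Matrix.of fun k => (ρ (Pi.single k 1) : Fin n → R)
  have hρA : ∀ w, (ρ w : Fin n → R) = Matrix.vecMul w A := by
    intro w
    conv_lhs => rw [pi_eq_sum_univ' w]
    ext j
    simp [Matrix.vecMul, dotProduct, A]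
  have hA : ∀ x, π x = 0 → ∃ w, x = Matrix.vecMul w A := by
    intro x hx
    obtain ⟨w, hw⟩ := hρ ⟨x, hx⟩
    exact ⟨w, by rw [← hρA, hw]⟩
  obtain ⟨z, hz⟩ := hπ σ
  -- A failure of divisibility by `s` gives a map `E → R ⧸ (s)` not killing `σ`, hence an embedding.
  -- If there is none, `z` is a combination of relations and `σ = 0`.
  obtain ⟨w, hw⟩ := hR.exists_eq_vecMul A z fun s y hy => by
    obtain ⟨f, hf⟩ := exists_hom_quotient_of_mulVec_mem π hπ A hA (Ideal.span {s}) y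
      fun k => Ideal.mem_span_singleton.2 (hy k)
    by_contra hs
    refine hE s f (LinearMap.ker_eq_bot.1 (hσ.ker_eq_bot f fun h => hs ?_))
    rw [← hz, hf] at h
    exact Ideal.mem_span_singleton.1 ((Submodule.Quotient.mk_eq_zero _).1 h)
  apply hσ.1
  rw [← hz, hw, ← hρA]
  exact (ρ w).2

/-- A finitely generated module with an essential element, which has the maximal length among such
modules with the same annihilator of the essential element, is injective. -/
theorem IsEssentialElement.baer_of_length_le [IsArtinianRing R] {E : Type u} [AddCommGroup E]
    [Module R E] [Module.Finite R E] {σ : E} (hσ : IsEssentialElement R σ)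
    (hmax : ∀ (Q : Type u) [AddCommGroup Q] [Module R Q] [Module.Finite R Q] (τ : Q),
      IsEssentialElement R τ → (∀ r : R, r • τ = 0 ↔ r • σ = 0) →
        Module.length R Q ≤ Module.length R E) :
    Module.Baer R E := by
  intro I g
  -- Dividing by `G` identifies `(0, x)` with `(g x, 0)`, so that `g` extends to `R`. Enlarging `G`
  -- to a maximal `C` missing `E` makes the extension of `E` essential, and maximal length then
  -- forces it to be trivial.
  let G : Submodule R (E × R) := LinearMap.range (g.prod (-I.subtype))
  have hG : Disjoint G (LinearMap.range (LinearMap.inl R E R)) := by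
    rw [Submodule.disjoint_def]
    rintro _ ⟨x, rfl⟩ ⟨e, he⟩
    have h2 : (0 : R) = -(x : R) := congrArg Prod.snd he
    have h3 : x = 0 := Subtype.ext (neg_eq_zero.1 h2.symm)
    simp [h3]
  obtain ⟨C, ⟨hGC, hC⟩, hCmax⟩ := (wellFounded_gt (α := Submodule R (E × R))).has_min
    {C : Submodule R (E × R) | G ≤ C ∧ Disjoint C (LinearMap.range (LinearMap.inl R E R))}
    ⟨G, le_rfl, hG⟩
  let ι : E →ₗ[R] (E × R) ⧸ C := C.mkQ ∘ₗ LinearMap.inl R E R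
  have hι : Function.Injective ι := by
    rw [injective_iff_map_eq_zero]
    intro e he
    have h1 : LinearMap.inl R E R e ∈ C := (Submodule.Quotient.mk_eq_zero _).1 he
    exact congrArg Prod.fst (Submodule.disjoint_def.1 hC _ h1 ⟨e, rfl⟩)
  have hισ : IsEssentialElement R (ι σ) := by
    refine ⟨fun h => hσ.1 (hι (h.trans (map_zero ι).symm)), fun N hN => ?_⟩
    refine hσ.2 (N.comap ι) fun hbot => ?_
    have hlt : C < N.comap C.mkQ := by
      refine lt_of_le_of_ne (Submodule.le_comap_mkQ C N) fun h => hN ?_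
      rw [← Submodule.map_comap_eq_of_surjective C.mkQ_surjective N, ← h, Submodule.mkQ_map_self]
    refine hCmax _ ⟨hGC.trans hlt.le, Submodule.disjoint_def.2 ?_⟩ hlt
    rintro _ hx ⟨e, rfl⟩
    have he : e ∈ N.comap ι := hx
    rw [hbot, Submodule.mem_bot] at he
    rw [he, map_zero]
  have hlen := hmax _ (ι σ) hισ fun r => by
    rw [← map_smul, map_eq_zero_iff ι hι]
  have hsurj : Function.Surjective ι := by
    rw [← LinearMap.range_eq_top]
    by_contra hne
    have := Submodule.length_lt hne
    rw [← (LinearEquiv.ofInjective ι hι).length_eq] at this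
    exact absurd hlen this.not_ge
  let e := LinearEquiv.ofBijective ι ⟨hι, hsurj⟩
  refine ⟨e.symm ∘ₗ C.mkQ ∘ₗ LinearMap.inr R E R, fun x hx => ?_⟩
  change e.symm (C.mkQ (0, x)) = _
  rw [LinearEquiv.symm_apply_eq]
  refine ((Submodule.Quotient.eq C).2 (hGC ⟨⟨x, hx⟩, ?_⟩)).symm
  simp

theorem IsEssentialElement.quotient_one (P : Ideal R) [P.IsMaximal] :
    IsEssentialElement R (1 : R ⧸ P) := by
  refine ⟨one_ne_zero, fun N hN => ?_⟩
  have : IsSimpleModule R (R ⧸ P) := isSimpleModule_iff_isCoatom.2 ‹P.IsMaximal›.out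
  rw [(eq_bot_or_eq_top N).resolve_left hN]
  trivial

/-- Over an artinian RD-injective ring, every simple module has an injective hull which is
cyclic. -/
theorem IsRDInjective.exists_baer_quotient [IsArtinianRing R] (hR : IsRDInjective R R)
    (P : Ideal R) [P.IsMaximal] :
    ∃ (J : Ideal R) (σ : R ⧸ J), Module.Baer R (R ⧸ J) ∧ IsEssentialElement R σ ∧
      ∀ r : R, r • σ = 0 ↔ r ∈ P := by
  let S : Set ℕ := {n | ∃ (E : Type u) (_ : AddCommGroup E) (_ : Module R E)
    (_ : Module.Finite R E) (σ : E), IsEssentialElement R σ ∧ (∀ r : R, r • σ = 0 ↔ r ∈ P) ∧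
      Module.length R E = n}
  have hlen (E : Type u) [AddCommGroup E] [Module R E] [Module.Finite R E] :
      Module.length R E = (Module.length R E).toNat :=
    (ENat.natCast_toNat Module.length_ne_top).symm
  have hne : S.Nonempty := ⟨_, R ⧸ P, inferInstance, inferInstance, inferInstance, 1,
    IsEssentialElement.quotient_one P, fun r => by
      rw [← Ideal.Quotient.eq_zero_iff_mem, Algebra.smul_def, mul_one]; rfl, hlen _⟩
  have hbdd : BddAbove S := by
    refine ⟨(Module.length R R).toNat, ?_⟩
    rintro n ⟨E, _, _, _, σ, hσ, -, hn⟩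
    obtain ⟨s, f, hf⟩ := hR.exists_injective_quotient_span hσ
    have := (Module.length_le_of_injective f hf).trans
      (Module.length_le_of_surjective _ (Submodule.mkQ_surjective (Ideal.span {s})))
    rw [hn, hlen R] at this
    exact_mod_cast this
  obtain ⟨E, _, _, _, σ, hσ, hP, hn⟩ := Nat.sSup_mem hne hbdd
  have hB : Module.Baer R E := hσ.baer_of_length_le fun Q _ _ _ τ hτ hτσ => by
    rw [hn, hlen Q]
    exact_mod_cast le_csSup hbdd
      ⟨Q, inferInstance, inferInstance, inferInstance, τ, hτ, fun r => (hτσ r).trans (hP r), hlen Q⟩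
  obtain ⟨s, f, hf⟩ := hR.exists_injective_quotient_span hσ
  -- Injectivity splits the embedding, so `E` is a quotient of `R ⧸ (s)`, hence cyclic.
  obtain ⟨g, hg⟩ := hB.extension_property f hf LinearMap.id
  let q : R →ₗ[R] E := g ∘ₗ Submodule.mkQ (Ideal.span {s})
  have hq : Function.Surjective q :=
    Function.Surjective.comp (g := g) (fun x => ⟨f x, LinearMap.congr_fun hg x⟩)
      (Submodule.mkQ_surjective _)
  let e := q.quotKerEquivOfSurjective hq
  refine ⟨LinearMap.ker q, e.symm σ, hB.of_equiv e.symm,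
    ⟨fun h => hσ.1 (by simpa using h), fun N hN => ?_⟩, fun r => ?_⟩
  · exact (Submodule.mem_comap (f := e.symm.toLinearMap)).1 <| hσ.2 _ fun h => hN <|
      Submodule.map_eq_bot_iff.1 ((Submodule.comap_equiv_eq_map_symm e.symm N).symm.trans h)
  · rw [← map_smul, e.symm.map_eq_zero_iff, hP]

/-- For `a ∈ P`, the element `1 - a * b` fixes `σ` and so acts injectively on `R ⧸ J`. The powers of
`a` stabilize modulo `J`, giving `(1 - a * b) * a ^ n ∈ J` for some `b`; hence `a ^ n ∈ J`. -/
theorem IsEssentialElement.le_of_le_isPrime [IsArtinianRing R] {J P M : Ideal R} [M.IsPrime]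
    {σ : R ⧸ J} (hσ : IsEssentialElement R σ) (hP : ∀ r ∈ P, r • σ = 0) (hM : J ≤ M) :
    P ≤ M := by
  intro a ha
  obtain ⟨n, y, hy⟩ := IsArtinian.exists_pow_succ_smul_dvd a (1 : R ⧸ J)
  obtain ⟨b, rfl⟩ := Ideal.Quotient.mk_surjective y
  have hinj := hσ.ker_eq_bot (LinearMap.lsmul R (R ⧸ J) (1 - a * b)) (by
    change (1 - a * b) • σ ≠ 0
    rw [sub_smul, one_smul, mul_comm, mul_smul, hP a ha, smul_zero, sub_zero]
    exact hσ.1)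
  have h0 : Ideal.Quotient.mk J (a ^ n) ∈ LinearMap.ker (LinearMap.lsmul R (R ⧸ J) (1 - a * b)) := by
    change Ideal.Quotient.mk J ((1 - a * b) * a ^ n) = 0
    have h1 : Ideal.Quotient.mk J (a ^ n.succ * b) = Ideal.Quotient.mk J (a ^ n * 1) := hy
    rw [← sub_eq_zero, ← map_sub] at h1
    rw [← neg_eq_zero, ← map_neg, ← h1]
    congr 1
    rw [Nat.succ_eq_add_one]
    ring
  rw [hinj, Submodule.mem_bot, Ideal.Quotient.eq_zero_iff_mem] at h0
  exact Ideal.IsPrime.mem_of_pow_mem ‹_› n (hM h0)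

/-- The assignment `x ↦ σ` is well defined on `Rx` and extends to `R` by injectivity, so `σ` is `x`
times an element of `R ⧸ J`; it would vanish if `x` were in `J`. -/
theorem Module.Baer.notMem_of_smul_eq_zero {J P : Ideal R} (hJ : Module.Baer R (R ⧸ J))
    {σ : R ⧸ J} (h0 : σ ≠ 0) (hP : ∀ r ∈ P, r • σ = 0) {x : R}
    (hx : ∀ r : R, r * x = 0 → r ∈ P) : x ∉ J := by
  intro hxJ
  let t := LinearMap.toSpanSingleton R R x
  have hker : LinearMap.ker t ≤ LinearMap.ker (LinearMap.toSpanSingleton R (R ⧸ J) σ) :=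
    fun r hr => hP r (hx r hr)
  obtain ⟨g, hg⟩ := hJ.extension_property ((LinearMap.ker t).liftQ t le_rfl)
    (LinearMap.ker_eq_bot.1 (Submodule.ker_liftQ_eq_bot _ _ _ le_rfl))
    ((LinearMap.ker t).liftQ _ hker)
  have h1 : g x = σ := by
    have h2 : g ((1 : R) • x) = (1 : R) • σ := LinearMap.congr_fun hg (Submodule.Quotient.mk 1)
    rwa [one_smul, one_smul] at h2
  apply h0
  obtain ⟨c, hc⟩ := Ideal.Quotient.mk_surjective (g 1)
  rw [← h1, ← mul_one x, ← smul_eq_mul, map_smul, ← hc]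
  exact Ideal.Quotient.eq_zero_iff_mem.2 (J.mul_mem_right c hxJ)

theorem IsRDInjective.injective_self [IsArtinianRing R] (hR : IsRDInjective R R) :
    Module.Injective R R := by
  choose J σ hJ hσ hP using fun P : MaximalSpectrum R =>
    have := P.isMaximal
    hR.exists_baer_quotient P.asIdeal
  have hcop : Pairwise (Function.onFun IsCoprime J) := by
    intro P Q hPQ
    rw [Function.onFun, Ideal.isCoprime_iff_sup_eq]
    by_contra hne
    obtain ⟨M, hM, hle⟩ := Ideal.exists_le_maximal _ hne
    have := hM.isPrime
    have hPM := (hσ P).le_of_le_isPrime (fun r hr => (hP P r).2 hr) (le_sup_left.trans hle)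
    have hQM := (hσ Q).le_of_le_isPrime (fun r hr => (hP Q r).2 hr) (le_sup_right.trans hle)
    -- A maximal ideal above both `J P` and `J Q` would equal both `P` and `Q`.
    exact hPQ (MaximalSpectrum.ext ((P.isMaximal.eq_of_le hM.ne_top hPM).trans
      (Q.isMaximal.eq_of_le hM.ne_top hQM).symm))
  let φ : R →ₗ[R] ∀ P, R ⧸ J P := LinearMap.pi fun P => Submodule.mkQ (J P)
  have hinj : Function.Injective φ := by
    rw [injective_iff_map_eq_zero]
    intro x hx
    by_contra hx0
    -- A nonzero `x` is detected at any maximal ideal containing its annihilator.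
    obtain ⟨M, hM, hle⟩ := Ideal.exists_le_maximal (LinearMap.ker (LinearMap.toSpanSingleton R R x))
      fun h => hx0 (by simpa using (Ideal.eq_top_iff_one _).1 h)
    refine (hJ ⟨M, hM⟩).notMem_of_smul_eq_zero (hσ _).1 (fun r hr => (hP ⟨M, hM⟩ r).2 hr)
      (fun r hr => hle hr) ((Submodule.Quotient.mk_eq_zero _).1 (congrFun hx ⟨M, hM⟩))
  have hsurj : Function.Surjective φ := by
    intro y
    obtain ⟨x, hx⟩ := Ideal.quotientInfToPiQuotient_surj hcop y
    obtain ⟨r, rfl⟩ := Ideal.Quotient.mk_surjective x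
    exact ⟨r, hx⟩
  have (P : MaximalSpectrum R) : Module.Injective R (R ⧸ J P) := (hJ P).injective
  have hpi : Module.Injective R (∀ P, R ⧸ J P) := inferInstance
  exact (Module.Baer.of_equiv (LinearEquiv.ofBijective φ ⟨hinj, hsurj⟩).symm
    (Module.Baer.of_injective hpi)).injective

theorem isRDInjective_of_injective {F : Type u} [AddCommGroup F] [Module R F]
    [Module.Injective R F] : IsRDInjective R F := by
  intro N M L _ _ _ _ _ _ f g ⟨⟨hf, hfg, hg⟩, _⟩
  refine ⟨LinearMap.lcomp_injective_of_surjective g hg,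
    LinearMap.exact_lcomp_of_exact_of_surjective F hfg hg, fun h => ?_⟩
  obtain ⟨k, hk⟩ := Module.Injective.out f hf h
  exact ⟨k, LinearMap.ext hk⟩

end

theorem propositionP (R : Type u) [CommRing R] [IsArtinianRing R] :
    IsRDInjective R R ↔ IsQuasiFrobenius R :=
  ⟨fun h => ⟨inferInstance, h.injective_self⟩, fun ⟨_, _⟩ => isRDInjective_of_injective⟩
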